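/- For $m\ge 1$ and positive integers $k_1,\dots,k_m$ with $k_1\ge 2$ let $$\zeta(k_1,\dots,k_m)=\sum_{n_1>n_2>\cdots>n_m>0}\frac{1}{n_1^{k_1}\cdots n_m^{k_m}}$$ be the (convergent) Euler–Zagier sum. A weighted vacuum graph $\Gamma$ is a finite directed multigraph (loops and parallel edges allowed) whose edges $e$ carry weights $k_e\in\{0,1,2,\dots\}$. Let $g^{(k)}(u)=\sum_{n\ge1}e^{2\pi i n u}/(2\pi i n)^k$. For $\lambda,g\in\mathbb C$ the Feynman rules of the $\zeta$-model assign to $\Gamma$ the value $$\prod_{v}\bar g^{\,p_v}g^{\,q_v}\int_{[0,1]^{V}}\prod_{e:\,v\to w}\lambda^{k_e}(2\pi i)^{k_e}\,g^{(k_e)}(u_v-u_w)\,du ,$$ where $p_v$ and $q_v$ are the numbers of edges ending and starting at the vertex $v$. Since $g^{(0)}$ is only a distribution, the integral is understood as follows: replace each $g^{(k_e)}$ by $\sum_{n\ge1}\rho_{j,e}(n)e^{2\pi i n u}/(2\pi i n)^{k_e}$ with $0\le\rho_{j,e}(n)\le1$ such that these series converge absolutely and $\rho_{j,e}(n)\to1$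 as $j\to\infty$ for all $e,n$; then $\Gamma$ has the value $a$ if for every such choice of $\rho$ the regularized expressions converge to $a$ as $j\to\infty$. The sea shell diagram of $(k_1,\dots,k_m)$ has vertices $v_0,\dots,v_{m-1}$, an edge of weight $k_i$ from $v_{i-1}$ to $v_i$ for $i=1,\dots,m$ (where $v_m=v_0$), and an edge of weight $0$ from $v_i$ to $v_0$ for $i=1,\dots,m-1$. Then, for all such $k_1,\dots,k_m$, the series for $\zeta(k_1,\dots,k_m)$ converges and, for all $\lambda,g\in\mathbb C$, the sea shell diagram has the value $$\lambda^{\sum_i k_i}\,(g\bar g)^{2m-1}\,\zeta(k_1,\dots,k_m).$$ Consequently, for $\lambda=g=1$ every convergent Euler–Zagier sum is the value of a weighted vacuum graph, and the $\mathbb Q$-linear extension of the map (graph with a finite value) $\mapsto$ (value) to formal $\mathbb Q$-linear combinations of such graphs has the whole $\mathbb Q$-vector space spanned by the Euler–Zagier sums in its image. -/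

import Mathlib

namespace ZetaModel

open Filter Topology MeasureTheory ComplexConjugate

/-! ### Euler-Zagier sums -/

/-- The term `1 / (n_1 ^ k_1 ⋯ n_m ^ k_m)`. -/
noncomputable def ezTerm {m : ℕ} (k : Fin m → ℕ) (n : Fin m → ℕ+) : ℝ :=
  ∏ i, 1 / ((n i : ℕ) : ℝ) ^ k i

/-- The index set `n_1 > n_2 > ⋯ > n_m > 0` of an Euler-Zagier sum. -/
abbrev DecreasingIndex (m : ℕ) : Type := {n : Fin m → ℕ+ // StrictAnti n}

/-- `ζ(k_1, …, k_m) = ∑_{n_1 > ⋯ > n_m > 0} 1 / (n_1 ^ k_1 ⋯ n_m ^ k_m)`;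
the exponent `k_{i+1}` of the text is `k i`. -/
noncomputable def eulerZagier {m : ℕ} (k : Fin m → ℕ) : ℝ :=
  ∑' n : DecreasingIndex m, ezTerm k n.1

/-- Positive exponents with `k_1 ≥ 2`: the convergent Euler-Zagier sums. -/
def Admissible {m : ℕ} [NeZero m] (k : Fin m → ℕ) : Prop :=
  (∀ i, 1 ≤ k i) ∧ 2 ≤ k 0

/-- The set of all (convergent) Euler-Zagier sums, of all lengths `m ≥ 1`. -/
def eulerZagierSums : Set ℂ :=
  {z | ∃ (m : ℕ) (_ : NeZero m) (k : Fin m → ℕ), Admissible k ∧ z = (eulerZagier k : ℂ)}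

/-! ### Weighted vacuum graphs and the Feynman rules of the `ζ`-model -/

/-- A weighted vacuum graph: a finite directed multigraph (loops and parallel edges allowed,
no external legs) whose edges, the propagators, carry a weight in `{0, 1, 2, …}`. -/
structure WeightedGraph where
  /-- vertices -/
  V : Type
  /-- edges -/
  E : Type
  [fintypeV : Fintype V]
  [fintypeE : Fintype E]
  /-- the initial vertex of an edge -/
  src : E → V
  /-- the final vertex of an edge -/
  tgt : E → V
  /-- an edge of weight `k` from `1` to `2` stands for `λ ^ k (2πi) ^ k g^{(k)}(u₁ - u₂)` -/
  weight : E → ℕ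

attribute [instance] WeightedGraph.fintypeV WeightedGraph.fintypeE

/-- The propagator `g^{(k)}(u) = ∑_{n ≥ 1} e^{2πinu} / (2πin)^k` with its `n`-th mode damped by the
factor `ρ n`. For `ρ = 1` this is the propagator itself, whenever its series converges
absolutely (`k ≥ 2`). -/
noncomputable def dampedPropagator (ρ : ℕ+ → ℝ) (k : ℕ) (u : ℝ) : ℂ :=
  ∑' n : ℕ+, (ρ n : ℂ) * (Complex.exp (2 * Real.pi * Complex.I * ((n : ℕ) : ℂ) * (u : ℂ)) /
    (2 * Real.pi * Complex.I * ((n : ℕ) : ℂ)) ^ k)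

namespace WeightedGraph

variable (Γ : WeightedGraph)

/-- A sequence of regularizations of the propagators of `Γ`. For each `j` every mode of every
propagator is damped by a factor in `[0, 1]`, such that the propagators become absolutely
convergent Fourier series; as `j → ∞` the damping disappears in each mode. This includes
momentum cutoffs (`ρ j e n = 1` for `n ≤ j`, `0` for `n > j`) and the boundary value
prescription `u → u + iε`, `ε → 0+` (`ρ j e n = r_j ^ n` with `r_j → 1-`), and no damping at all
for the propagators of weight at least `2`. -/
structure IsRegularization (ρ : ℕ → Γ.E → ℕ+ → ℝ) : Prop where
  nonneg : ∀ j e n, 0 ≤ ρ j e n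
  le_one : ∀ j e n, ρ j e n ≤ 1
  summable : ∀ j e, Summable fun n : ℕ+ => ρ j e n / ((n : ℕ) : ℝ) ^ Γ.weight e
  tendsto : ∀ e n, Tendsto (fun j => ρ j e n) atTop (𝓝 1)

/-- The product of the vertex factors `ḡ^p g^q` over all vertices, for a vertex with `p` ingoing
and `q` outgoing propagators. -/
noncomputable def vertexFactor (g : ℂ) : ℂ :=
  ∏ v : Γ.V, (conj g) ^ Nat.card {e : Γ.E // Γ.tgt e = v} * g ^ Nat.card {e : Γ.E // Γ.src e = v}

/-- The Feynman integral of `Γ` with damped propagators: every vertex `v` has a position `u v`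
that is integrated over `[0, 1]`, and every edge from `v` to `w` of weight `k` contributes
`λ^k (2πi)^k g^{(k)}(u v - u w)`. -/
noncomputable def dampedAmplitude (lam g : ℂ) (ρ : Γ.E → ℕ+ → ℝ) : ℂ :=
  Γ.vertexFactor g *
    ∫ u : Γ.V → ℝ in Set.univ.pi fun _ => Set.Icc (0 : ℝ) 1,
      ∏ e : Γ.E, lam ^ Γ.weight e * (2 * Real.pi * Complex.I) ^ Γ.weight e *
        dampedPropagator (ρ e) (Γ.weight e) (u (Γ.src e) - u (Γ.tgt e))

/-- `Γ` evaluates to `a`: the regularized Feynman integrals converge to `a`, whichever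
regularization is used. (For `k = 0` the series `g^{(0)}` is a distribution only, so that the
Feynman integral is a pairing of a product of distributions with the constant `1`.) -/
def HasValue (lam g a : ℂ) : Prop :=
  ∀ ρ : ℕ → Γ.E → ℕ+ → ℝ, Γ.IsRegularization ρ →
    Tendsto (fun j => Γ.dampedAmplitude lam g (ρ j)) atTop (𝓝 a)

/-- The momentum cutoffs form a regularization. -/
theorem isRegularization_cutoff :
    Γ.IsRegularization fun j _ n => if (n : ℕ) ≤ j then 1 else 0 where
  nonneg j e n := by split_ifs <;> norm_num
  le_one j e n := by split_ifs <;> norm_num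
  summable j e := by
    have hfin : (Set.Iic (Nat.toPNat' (j + 1))).Finite := Set.finite_Iic _
    refine summable_of_ne_finset_zero (s := hfin.toFinset) fun n hn => ?_
    have hlt : ¬ ((n : ℕ) ≤ j) := by
      intro h
      apply hn
      rw [Set.Finite.mem_toFinset, Set.mem_Iic, ← PNat.coe_le_coe, Nat.toPNat'_coe]
      simp only [Nat.succ_pos, if_true]
      omega
    simp [hlt]
  tendsto e n := by
    refine tendsto_const_nhds.congr' ?_
    filter_upwards [eventually_ge_atTop (n : ℕ)] with j hj
    simp [hj]

theorem HasValue.unique {lam g a b : ℂ} (ha : Γ.HasValue lam g a) (hb : Γ.HasValue lam g b) :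
    a = b :=
  tendsto_nhds_unique (ha _ Γ.isRegularization_cutoff) (hb _ Γ.isRegularization_cutoff)

end WeightedGraph

/-- The weighted vacuum graphs with a (finite) value, the coupling constants being set to `1`. -/
abbrev EvaluableGraph : Type 1 := {Γ : WeightedGraph // ∃ a : ℂ, Γ.HasValue 1 1 a}

/-- The map that sends a weighted vacuum graph to its value, the coupling constants being set
to `1`. By `WeightedGraph.HasValue.unique` it involves no choice. -/
noncomputable def graphValue (Γ : EvaluableGraph) : ℂ := Γ.2.choose

theorem graphValue_spec (Γ : EvaluableGraph) : Γ.1.HasValue 1 1 (graphValue Γ) :=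
  Γ.2.choose_spec

/-! ### The sea shell diagram -/

/-- The sea shell diagram of `(k_1, …, k_m)`. It has the vertices `0, …, m - 1`, where `0` is the
root. The outer propagators of weights `k_1, …, k_m` run cyclically
`0 → 1 → ⋯ → m - 1 → 0` (addition in `Fin m` is modulo `m`; for `m = 1` there is just a loop at the
root), and from every vertex `i ≠ 0` an inserted propagator of weight `0` runs to the root. -/
def seaShell {m : ℕ} [NeZero m] (k : Fin m → ℕ) : WeightedGraph where
  V := Fin m
  E := Fin m ⊕ {i : Fin m // i ≠ 0}
  src := Sum.elim (fun i => i) (fun i => i.1)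
  tgt := Sum.elim (fun i => i + 1) (fun _ => 0)
  weight := Sum.elim k (fun _ => 0)

end ZetaModel

namespace ZetaModel

open Filter Topology MeasureTheory ComplexConjugate

/-! ### Products of absolutely convergent series -/

/-! Expanding every damped propagator into Fourier modes and integrating over the vertex positions
leaves a sum over positive integer edge momenta that are conserved at each vertex
(`dampedAmplitude_eq_tsum`). In the sea shell, conservation at a vertex other than the root says
that the outer momentum drops there by the inserted momentum. The latter is a positive integer, so
the outer momenta strictly decrease; conversely, a strictly decreasing sequence determines the
inserted momenta (`seaShell_momentum_eq_zero_iff`). Conservation at the root is then automatic.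
Inserted edges have weight `0` and contribute only damping, so the regularized amplitude is, up to
the coupling constants, the Euler-Zagier series with each term multiplied by a factor in `[0, 1]`.
Dominated convergence, with `summable_ezTerm` supplying the majorant, removes the damping for every
regularization. The claims about values and spans follow by uniqueness of limits. -/

theorem summable_norm_and_tsum_prod_fin {N : ℕ} {ι R : Type*} [NormedCommRing R] [CompleteSpace R]
    [NormOneClass R] (f : Fin N → ι → R) (hf : ∀ i, Summable fun x => ‖f i x‖) :
    (Summable fun n : Fin N → ι => ‖∏ i, f i (n i)‖) ∧
      ∑' n : Fin N → ι, ∏ i, f i (n i) = ∏ i, ∑' x, f i x := by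
  -- Both claims go through the induction together: the product formula for the series needs
  -- absolute summability of the tail.
  induction N with
  | zero => simp [(hasSum_fintype _).summable]
  | succ N ih =>
    obtain ⟨h1, h2⟩ := ih (fun i => f i.succ) fun i => hf i.succ
    let e : ι × (Fin N → ι) ≃ (Fin (N + 1) → ι) := Fin.consEquiv fun _ => ι
    have he : ∀ p, ∏ i, f i (e p i) = f 0 p.1 * ∏ i : Fin N, f i.succ (p.2 i) := by
      intro p
      rw [Fin.prod_univ_succ]
      rfl
    constructor
    · rw [← e.summable_iff]
      simpa only [Function.comp_def, he] using (hf 0).mul_norm h1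
    · rw [← e.tsum_eq, Fin.prod_univ_succ, ← h2, tsum_mul_tsum_of_summable_norm (hf 0) h1]
      exact tsum_congr he

theorem summable_norm_prod_pi {κ ι R : Type*} [Fintype κ] [NormedCommRing R] [CompleteSpace R]
    [NormOneClass R] (f : κ → ι → R) (hf : ∀ i, Summable fun x => ‖f i x‖) :
    Summable fun n : κ → ι => ‖∏ i, f i (n i)‖ := by
  let e := (Fintype.equivFin κ).symm
  have h := (summable_norm_and_tsum_prod_fin (fun i => f (e i)) fun i => hf (e i)).1
  rw [← (e.arrowCongr (Equiv.refl ι)).summable_iff]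
  refine h.congr fun n => ?_
  rw [Function.comp_apply, ← e.prod_comp]
  simp

theorem tsum_prod_pi {κ ι R : Type*} [Fintype κ] [NormedCommRing R] [CompleteSpace R]
    [NormOneClass R] (f : κ → ι → R) (hf : ∀ i, Summable fun x => ‖f i x‖) :
    ∑' n : κ → ι, ∏ i, f i (n i) = ∏ i, ∑' x, f i x := by
  let e := (Fintype.equivFin κ).symm
  have h := (summable_norm_and_tsum_prod_fin (fun i => f (e i)) fun i => hf (e i)).2
  rw [← (e.arrowCongr (Equiv.refl ι)).tsum_eq, ← e.prod_comp, ← h]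
  refine tsum_congr fun n => ?_
  rw [← e.prod_comp]
  simp

/-! ### Convergence of the Euler-Zagier sums -/

theorem ezTerm_nonneg {m : ℕ} (k : Fin m → ℕ) (n : Fin m → ℕ+) : 0 ≤ ezTerm k n :=
  Finset.prod_nonneg fun _ _ => by positivity

/-- Since `k 0 ≥ 2`, one factor `1 / n 0` can be spared. As `n 0` is the largest index, this factor
can be shared out equally among the `m` variables, which lifts each exponent above `1` and decouples
the variables. -/
theorem ezTerm_le_prod_rpow {m : ℕ} [NeZero m] {k : Fin m → ℕ} (hk : Admissible k)
    {n : Fin m → ℕ+} (hn : StrictAnti n) :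
    ezTerm k n ≤ ∏ i, ((n i : ℕ) : ℝ) ^ (-(1 + 1 / (m : ℝ))) := by
  have hm : (m : ℝ) ≠ 0 := Nat.cast_ne_zero.2 (NeZero.ne m)
  have hone : ∀ i, (1 : ℝ) ≤ ((n i : ℕ) : ℝ) := fun i => by exact_mod_cast (n i).pos
  have hpos : ∀ i, (0 : ℝ) < ((n i : ℕ) : ℝ) := fun i => zero_lt_one.trans_le (hone i)
  have h0 : (((n 0 : ℕ) : ℝ))⁻¹ ≤ ∏ i, ((n i : ℕ) : ℝ) ^ (-(1 / (m : ℝ))) := by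
    calc (((n 0 : ℕ) : ℝ))⁻¹ = ∏ _i : Fin m, ((n 0 : ℕ) : ℝ) ^ (-(1 / (m : ℝ))) := by
          rw [Finset.prod_const, Finset.card_univ, Fintype.card_fin, ← Real.rpow_natCast,
            ← Real.rpow_mul (hpos 0).le, neg_mul, one_div_mul_cancel hm, Real.rpow_neg_one]
      _ ≤ _ := by
          refine Finset.prod_le_prod (fun _ _ => by positivity) fun i _ => ?_
          refine Real.rpow_le_rpow_of_nonpos (hpos i) ?_ (by simp)
          exact_mod_cast hn.antitone (Fin.zero_le i)
  have h1 : ezTerm k n ≤ (((n 0 : ℕ) : ℝ))⁻¹ * ∏ i, (((n i : ℕ) : ℝ))⁻¹ := by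
    have hif : (((n 0 : ℕ) : ℝ))⁻¹ = ∏ i, if i = 0 then (((n i : ℕ) : ℝ))⁻¹ else 1 := by simp
    rw [hif, ← Finset.prod_mul_distrib]
    refine Finset.prod_le_prod (fun _ _ => by positivity) fun i _ => ?_
    rw [one_div, ← inv_pow]
    have hi0 : 0 ≤ (((n i : ℕ) : ℝ))⁻¹ := (inv_pos.2 (hpos i)).le
    have hi1 : (((n i : ℕ) : ℝ))⁻¹ ≤ 1 := inv_le_one_of_one_le₀ (hone i)
    split_ifs with h
    · rw [← sq]
      exact pow_le_pow_of_le_one hi0 hi1 (h ▸ hk.2)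
    · rw [one_mul]
      exact (pow_le_pow_of_le_one hi0 hi1 (hk.1 i)).trans_eq (pow_one _)
  refine h1.trans ((mul_le_mul_of_nonneg_right h0
    (Finset.prod_nonneg fun _ _ => by positivity)).trans_eq ?_)
  rw [← Finset.prod_mul_distrib]
  refine Finset.prod_congr rfl fun i _ => ?_
  rw [neg_add_rev, Real.rpow_add (hpos i), Real.rpow_neg_one]

theorem summable_ezTerm {m : ℕ} [NeZero m] {k : Fin m → ℕ} (hk : Admissible k) :
    Summable fun n : DecreasingIndex m => ezTerm k n.1 := by
  have hm : (0 : ℝ) < m := Nat.cast_pos.2 (NeZero.pos m)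
  have h1 : Summable fun n : ℕ+ => ‖((n : ℕ) : ℝ) ^ (-(1 + 1 / (m : ℝ)))‖ := by
    refine (Summable.norm ?_)
    have h := Real.summable_nat_rpow (p := -(1 + 1 / (m : ℝ)))
    have h' := h.2 (by have : 0 < 1 / (m : ℝ) := by positivity
                       linarith)
    exact h'.comp_injective PNat.coe_injective
  have h2 := (summable_norm_prod_pi (fun (_ : Fin m) (n : ℕ+) =>
    ((n : ℕ) : ℝ) ^ (-(1 + 1 / (m : ℝ)))) fun _ => h1).of_norm
  exact Summable.of_nonneg_of_le (fun n => ezTerm_nonneg k n.1)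
    (fun n => ezTerm_le_prod_rpow hk n.2) (h2.comp_injective Subtype.val_injective)

/-! ### Momentum space Feynman rules -/

theorem setIntegral_exp_two_pi_mul_I (p : ℤ) :
    ∫ u in Set.Icc (0 : ℝ) 1, Complex.exp (2 * Real.pi * Complex.I * (p : ℂ) * (u : ℂ)) =
      if p = 0 then 1 else 0 := by
  rw [integral_Icc_eq_integral_Ioc, ← intervalIntegral.integral_of_le zero_le_one]
  split_ifs with h
  · simp [h]
  · have hc : 2 * Real.pi * Complex.I * (p : ℂ) ≠ 0 := by
      simp [h, Real.pi_ne_zero]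
    rw [integral_exp_mul_complex hc]
    have : 2 * Real.pi * Complex.I * (p : ℂ) * ((1 : ℝ) : ℂ) = p * (2 * Real.pi * Complex.I) := by
      push_cast
      ring
    rw [this, Complex.exp_int_mul_two_pi_mul_I]
    simp

namespace WeightedGraph

variable (Γ : WeightedGraph)

open Classical in
/-- The total momentum flowing out of the vertex `v` if the edge `e` carries the momentum `n e`. -/
noncomputable def momentum (n : Γ.E → ℕ+) (v : Γ.V) : ℤ :=
  ∑ e, (n e : ℤ) * ((if Γ.src e = v then 1 else 0) - (if Γ.tgt e = v then 1 else 0))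

/-- Each edge leaves one vertex and enters one, so its contributions cancel. One conservation law is
therefore redundant. -/
theorem sum_momentum (n : Γ.E → ℕ+) : ∑ v, Γ.momentum n v = 0 := by
  classical
  simp only [momentum]
  rw [Finset.sum_comm]
  simp [← Finset.mul_sum]

theorem sum_momentum_mul (n : Γ.E → ℕ+) (u : Γ.V → ℝ) :
    ∑ v, (Γ.momentum n v : ℂ) * (u v : ℂ) =
      ∑ e, ((n e : ℕ) : ℂ) * ((u (Γ.src e) - u (Γ.tgt e) : ℝ) : ℂ) := by
  classical
  simp only [momentum, Int.cast_sum, Finset.sum_mul]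
  rw [Finset.sum_comm]
  refine Finset.sum_congr rfl fun e _ => ?_
  push_cast
  simp [mul_assoc, ← Finset.mul_sum, sub_mul]

-- Regrouping the phases by vertex gives a product of one-variable characters, so the integral
-- factors into Kronecker deltas.
open Classical in
theorem setIntegral_prod_exp (n : Γ.E → ℕ+) :
    ∫ u : Γ.V → ℝ in Set.univ.pi fun _ => Set.Icc (0 : ℝ) 1,
      ∏ e, Complex.exp (2 * Real.pi * Complex.I * ((n e : ℕ) : ℂ) *
        ((u (Γ.src e) - u (Γ.tgt e) : ℝ) : ℂ)) =
      if ∀ v, Γ.momentum n v = 0 then 1 else 0 := by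
  have h : ∀ u : Γ.V → ℝ, ∏ e, Complex.exp (2 * Real.pi * Complex.I * ((n e : ℕ) : ℂ) *
      ((u (Γ.src e) - u (Γ.tgt e) : ℝ) : ℂ)) =
      ∏ v, Complex.exp (2 * Real.pi * Complex.I * (Γ.momentum n v : ℂ) * (u v : ℂ)) := by
    intro u
    rw [← Complex.exp_sum, ← Complex.exp_sum]
    congr 1
    simp only [mul_assoc, ← Finset.mul_sum]
    rw [sum_momentum_mul]
  simp only [h]
  rw [volume_pi, Measure.restrict_pi_pi, integral_fintype_prod_eq_prod
    (f := fun v (x : ℝ) => Complex.exp (2 * Real.pi * Complex.I * (Γ.momentum n v : ℂ) * (x : ℂ)))]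
  simp only [setIntegral_exp_two_pi_mul_I, Finset.prod_ite_zero, Finset.mem_univ, true_imp_iff,
    Finset.prod_const_one]

theorem norm_exp_mode (n : ℕ+) (x : ℝ) :
    ‖Complex.exp (2 * Real.pi * Complex.I * ((n : ℕ) : ℂ) * (x : ℂ))‖ = 1 := by
  have : 2 * Real.pi * Complex.I * ((n : ℕ) : ℂ) * (x : ℂ) =
      ((2 * Real.pi * (n : ℕ) * x : ℝ) : ℂ) * Complex.I := by
    push_cast
    ring
  rw [this, Complex.norm_exp_ofReal_mul_I]

/-- Every edge has exactly one start and one end, so either family of exponents sums to the number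
of edges. -/
theorem vertexFactor_eq (g : ℂ) : Γ.vertexFactor g = (g * conj g) ^ Fintype.card Γ.E := by
  have h : ∀ f : Γ.E → Γ.V, ∑ v, Nat.card {e : Γ.E // f e = v} = Fintype.card Γ.E := by
    intro f
    rw [← Nat.card_sigma, Nat.card_congr (Equiv.sigmaFiberEquiv f), Nat.card_eq_fintype_card]
  rw [vertexFactor, Finset.prod_mul_distrib, Finset.prod_pow_eq_pow_sum,
    Finset.prod_pow_eq_pow_sum, h, h, mul_pow, mul_comm]

/-- The coefficient of a mode in momentum space: the product of the damped propagators. -/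
noncomputable def momentumWeight (ρ : Γ.E → ℕ+ → ℝ) (n : Γ.E → ℕ+) : ℂ :=
  ∏ e, ((ρ e (n e) / ((n e : ℕ) : ℝ) ^ Γ.weight e : ℝ) : ℂ)

theorem two_pi_I_pow_mul_dampedPropagator (ρ : ℕ+ → ℝ) (k : ℕ) (x : ℝ) :
    (2 * Real.pi * Complex.I) ^ k * dampedPropagator ρ k x =
      ∑' n : ℕ+, ((ρ n / ((n : ℕ) : ℝ) ^ k : ℝ) : ℂ) *
        Complex.exp (2 * Real.pi * Complex.I * ((n : ℕ) : ℂ) * (x : ℂ)) := by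
  rw [dampedPropagator, ← tsum_mul_left]
  refine tsum_congr fun n => ?_
  have hn : ((n : ℕ) : ℂ) ≠ 0 := Nat.cast_ne_zero.2 n.ne_zero
  have hpi : 2 * Real.pi * Complex.I ≠ 0 := Complex.two_pi_I_ne_zero
  rw [mul_pow _ ((n : ℕ) : ℂ)]
  push_cast
  -- This lets `field_simp` treat `2πi` as a single nonzero atom.
  generalize 2 * (Real.pi : ℂ) * Complex.I = c at hpi
  field_simp

open Classical in
/-- Momentum space Feynman rules. -/
theorem dampedAmplitude_eq_tsum (lam g : ℂ) (ρ : Γ.E → ℕ+ → ℝ) (hρ : ∀ e n, 0 ≤ ρ e n)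
    (hs : ∀ e, Summable fun n : ℕ+ => ρ e n / ((n : ℕ) : ℝ) ^ Γ.weight e) :
    Γ.dampedAmplitude lam g ρ =
      (g * conj g) ^ Fintype.card Γ.E * (lam ^ (∑ e, Γ.weight e) *
        ∑' n : Γ.E → ℕ+, if ∀ v, Γ.momentum n v = 0 then Γ.momentumWeight ρ n else 0) := by
  let F : (Γ.E → ℕ+) → (Γ.V → ℝ) → ℂ := fun n u => Γ.momentumWeight ρ n *
    ∏ e, Complex.exp (2 * Real.pi * Complex.I * ((n e : ℕ) : ℂ) *
      ((u (Γ.src e) - u (Γ.tgt e) : ℝ) : ℂ))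
  have hs' : ∀ e, Summable fun n : ℕ+ =>
      ‖((ρ e n / ((n : ℕ) : ℝ) ^ Γ.weight e : ℝ) : ℂ)‖ := by
    intro e
    refine (hs e).congr fun n => ?_
    rw [Complex.norm_real, Real.norm_of_nonneg (div_nonneg (hρ e n) (by positivity))]
  have hW : Summable fun n => ‖Γ.momentumWeight ρ n‖ := summable_norm_prod_pi
    (fun e (n : ℕ+) => ((ρ e n / ((n : ℕ) : ℝ) ^ Γ.weight e : ℝ) : ℂ)) hs'
  have hnorm : ∀ n u, ‖F n u‖ = ‖Γ.momentumWeight ρ n‖ := by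
    intro n u
    simp only [F, norm_mul, norm_prod, norm_exp_mode, Finset.prod_const_one, mul_one]
  have hvol : (volume.restrict (Set.univ.pi fun _ : Γ.V => Set.Icc (0 : ℝ) 1)) Set.univ = 1 := by
    rw [Measure.restrict_apply_univ, volume_pi_pi]
    simp
  have : IsFiniteMeasure (volume.restrict (Set.univ.pi fun _ : Γ.V => Set.Icc (0 : ℝ) 1)) :=
    ⟨by rw [hvol]; exact ENNReal.one_lt_top⟩
  have hint : ∀ n, Integrable (F n)
      (volume.restrict (Set.univ.pi fun _ : Γ.V => Set.Icc (0 : ℝ) 1)) := by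
    intro n
    refine Integrable.of_bound (C := ‖Γ.momentumWeight ρ n‖) ?_ ?_
    · exact Continuous.aestronglyMeasurable (by fun_prop)
    · exact Eventually.of_forall fun u => (hnorm n u).le
  -- Sum and integral may be exchanged: the phases have modulus one and the cube has volume one, so
  -- the integrated norms are those of the summable momentum weights.
  have hsum := hasSum_integral_of_summable_integral_norm hint (by
    simpa only [hnorm, integral_const, Measure.real, hvol, ENNReal.toReal_one, one_smul] using hW)
  rw [dampedAmplitude, vertexFactor_eq]
  congr 1
  have hF : ∀ u : Γ.V → ℝ, ∏ e, lam ^ Γ.weight e * (2 * Real.pi * Complex.I) ^ Γ.weight e *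
      dampedPropagator (ρ e) (Γ.weight e) (u (Γ.src e) - u (Γ.tgt e)) =
      lam ^ (∑ e, Γ.weight e) * ∑' n, F n u := by
    intro u
    simp only [mul_assoc (lam ^ _), two_pi_I_pow_mul_dampedPropagator]
    rw [Finset.prod_mul_distrib, Finset.prod_pow_eq_pow_sum, ← tsum_prod_pi]
    · simp only [Finset.prod_mul_distrib]
      rfl
    · intro e
      simpa only [norm_mul, norm_exp_mode, mul_one] using hs' e
  simp only [hF, integral_const_mul]
  rw [← hsum.tsum_eq]
  congr 1
  refine tsum_congr fun n => ?_
  simp only [F, integral_const_mul, setIntegral_prod_exp, mul_ite, mul_one, mul_zero]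

end WeightedGraph

/-! ### The sea shell diagram in momentum space -/

/-- Subtraction in `Fin m` is cyclic but wraps around only at `0`; away from the root, the
predecessor along the shell is the predecessor in the order. -/
theorem fin_sub_one_lt_of_ne_zero {m : ℕ} [NeZero m] {i : Fin m} (hi : i ≠ 0) : i - 1 < i := by
  obtain ⟨m, rfl⟩ := Nat.exists_eq_succ_of_ne_zero (NeZero.ne m)
  exact Fin.sub_one_lt_iff.2 (Fin.pos_iff_ne_zero.2 hi)

theorem fin_strictAnti_of_lt_sub_one {m : ℕ} [NeZero m] {α : Type*} [Preorder α] {f : Fin m → α}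
    (hf : ∀ i, i ≠ 0 → f i < f (i - 1)) : StrictAnti f := by
  obtain ⟨m, rfl⟩ := Nat.exists_eq_succ_of_ne_zero (NeZero.ne m)
  refine Fin.strictAnti_iff_succ_lt.2 fun i => ?_
  have h := hf i.succ (Fin.succ_ne_zero i)
  rwa [show i.succ - 1 = i.castSucc by rw [sub_eq_iff_eq_add, Fin.coeSucc_eq_succ]] at h

theorem sum_mul_ite_eq_of_iff {ι R : Type*} [Fintype ι] [NonAssocSemiring R] (a : ι → R) {i : ι}
    {p : ι → Prop} [DecidablePred p] (hp : ∀ j, p j ↔ j = i) :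
    ∑ j, a j * (if p j then 1 else 0) = a i := by
  classical
  simp [hp]

section

variable {m : ℕ} [NeZero m] (k : Fin m → ℕ)

/-- The momenta of the propagators of the sea shell diagram, given those of the outer ones. -/
def seaShellMomenta (d : Fin m → ℕ+) : (seaShell k).E → ℕ+ :=
  Sum.elim d fun i => d (i.1 - 1) - d i.1

theorem seaShellMomenta_injective : Function.Injective (seaShellMomenta k) := fun _ _ h =>
  funext fun i => congrFun h (Sum.inl i)

theorem card_seaShell_E : Fintype.card (seaShell k).E = 2 * m - 1 := by
  have h : Fintype.card (seaShell k).E = Fintype.card (Fin m ⊕ {i : Fin m // i ≠ 0}) :=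
    Fintype.card_congr (Equiv.refl _)
  rw [h, Fintype.card_sum, Fintype.card_fin, Fintype.card_subtype_compl, Fintype.card_fin,
    Fintype.card_subtype_eq]
  omega

theorem prod_seaShell_E {M : Type*} [CommMonoid M] (f : (seaShell k).E → M) :
    ∏ e, f e = (∏ i : Fin m, f (Sum.inl i)) * ∏ i : {i : Fin m // i ≠ 0}, f (Sum.inr i) :=
  Fintype.prod_sum_type (α₁ := Fin m) (α₂ := {i : Fin m // i ≠ 0}) f

theorem sum_seaShell_E {M : Type*} [AddCommMonoid M] (f : (seaShell k).E → M) :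
    ∑ e, f e = (∑ i : Fin m, f (Sum.inl i)) + ∑ i : {i : Fin m // i ≠ 0}, f (Sum.inr i) :=
  Fintype.sum_sum_type (α₁ := Fin m) (α₂ := {i : Fin m // i ≠ 0}) f

theorem sum_seaShell_weight : ∑ e, (seaShell k).weight e = ∑ i, k i := by
  rw [sum_seaShell_E]
  simp [seaShell]

theorem seaShell_momentum_of_ne_zero (n : (seaShell k).E → ℕ+) {i : Fin m} (hi : i ≠ 0) :
    (seaShell k).momentum n i =
      (n (Sum.inl i) : ℤ) - (n (Sum.inl (i - 1)) : ℤ) + (n (Sum.inr ⟨i, hi⟩) : ℤ) := by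
  classical
  unfold WeightedGraph.momentum
  rw [sum_seaShell_E]
  have hout : ∑ j : Fin m, (n (Sum.inl j) : ℤ) *
      ((if j = i then 1 else 0) - (if j + 1 = i then 1 else 0)) =
      (n (Sum.inl i) : ℤ) - (n (Sum.inl (i - 1)) : ℤ) := by
    simp only [mul_sub, Finset.sum_sub_distrib]
    rw [sum_mul_ite_eq_of_iff (fun j : Fin m => (n (Sum.inl j) : ℤ)) fun _ => Iff.rfl,
      sum_mul_ite_eq_of_iff (fun j : Fin m => (n (Sum.inl j) : ℤ)) fun _ => eq_sub_iff_add_eq.symm]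
  have hins : ∑ j : {j : Fin m // j ≠ 0}, (n (Sum.inr j) : ℤ) *
      ((if j.1 = i then 1 else 0) - (if (0 : Fin m) = i then 1 else 0)) =
      (n (Sum.inr ⟨i, hi⟩) : ℤ) := by
    simp only [hi.symm, if_false, sub_zero]
    exact sum_mul_ite_eq_of_iff (fun j : {j : Fin m // j ≠ 0} => (n (Sum.inr j) : ℤ))
      fun j => (Subtype.ext_iff (a2 := ⟨i, hi⟩)).symm
  -- Up to unfolding `seaShell`, the sides then differ only in their decidability instances, which
  -- `congr!` reconciles.
  rw [← hout, ← hins]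
  congr!

theorem seaShell_momentum_eq_zero_iff (n : (seaShell k).E → ℕ+) :
    (∀ v, (seaShell k).momentum n v = 0) ↔ ∃ d : DecreasingIndex m, seaShellMomenta k d.1 = n := by
  constructor
  · intro h
    have hn : ∀ (i : Fin m) (hi : i ≠ 0),
        n (Sum.inl (i - 1)) = n (Sum.inl i) + n (Sum.inr ⟨i, hi⟩) := by
      intro i hi
      have := h i
      rw [seaShell_momentum_of_ne_zero k n hi] at this
      have h' : ((n (Sum.inl (i - 1)) : ℕ) : ℤ) =
          (n (Sum.inl i) : ℕ) + (n (Sum.inr ⟨i, hi⟩) : ℕ) := by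
        linarith
      exact PNat.coe_injective (by rw [PNat.add_coe]; exact_mod_cast h')
    refine ⟨⟨fun i => n (Sum.inl i), fin_strictAnti_of_lt_sub_one fun i hi => ?_⟩, ?_⟩
    · rw [hn i hi]
      exact PNat.lt_add_right _ _
    · funext e
      rcases e with i | ⟨i, hi⟩
      · rfl
      · change n (Sum.inl (i - 1)) - n (Sum.inl i) = n (Sum.inr ⟨i, hi⟩)
        rw [hn i hi, add_comm]
        exact PNat.add_sub
  · rintro ⟨d, rfl⟩
    have h : ∀ i : Fin m, i ≠ 0 →
        (seaShell k).momentum (seaShellMomenta k d.1) i = 0 := by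
      intro i hi
      rw [seaShell_momentum_of_ne_zero k _ hi]
      -- Subtraction in `ℕ+` is truncated at `1`; strict decrease makes it the true difference.
      have hd := PNat.add_sub_of_lt (d.2 (fin_sub_one_lt_of_ne_zero hi))
      have hd' : ((d.1 (i - 1) : ℕ) : ℤ) = (d.1 i : ℕ) + ((d.1 (i - 1) - d.1 i : ℕ+) : ℕ) := by
        rw [← Nat.cast_add, ← PNat.add_coe, hd]
      change ((d.1 i : ℕ) : ℤ) - (d.1 (i - 1) : ℕ) + ((d.1 (i - 1) - d.1 i : ℕ+) : ℕ) = 0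
      linarith
    have h0 : (seaShell k).momentum (seaShellMomenta k d.1) (0 : Fin m) = 0 := by
      have hsum := (seaShell k).sum_momentum (seaShellMomenta k d.1)
      exact (Fintype.sum_eq_single (α := (seaShell k).V) (0 : Fin m) h).symm.trans hsum
    intro v
    by_cases hv : v = (0 : Fin m)
    · rw [hv, h0]
    · exact h v hv

open Classical in
theorem tsum_seaShell (F : ((seaShell k).E → ℕ+) → ℂ) :
    (∑' n, if ∀ v, (seaShell k).momentum n v = 0 then F n else 0) =
      ∑' d : DecreasingIndex m, F (seaShellMomenta k d.1) := by
  have hinj : Function.Injective fun d : DecreasingIndex m => seaShellMomenta k d.1 :=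
    (seaShellMomenta_injective k).comp Subtype.val_injective
  -- The summand is supported on the range of this injection, so the sum can be reindexed along it.
  rw [← hinj.tsum_eq]
  · exact tsum_congr fun d => if_pos ((seaShell_momentum_eq_zero_iff k _).2 ⟨d, rfl⟩)
  · intro n hn
    by_contra h
    exact hn (if_neg fun h' => h ((seaShell_momentum_eq_zero_iff k n).1 h'))

theorem seaShell_momentumWeight (ρ : (seaShell k).E → ℕ+ → ℝ) (d : Fin m → ℕ+) :
    (seaShell k).momentumWeight ρ (seaShellMomenta k d) =
      (((∏ e, ρ e (seaShellMomenta k d e)) * ezTerm k d : ℝ) : ℂ) := by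
  rw [WeightedGraph.momentumWeight, ← Complex.ofReal_prod]
  simp only [div_eq_mul_one_div (ρ _ _), Finset.prod_mul_distrib]
  congr 2
  rw [prod_seaShell_E]
  simp [seaShell, seaShellMomenta, ezTerm]

variable {k}

theorem hasValue_seaShell (hk : Admissible k) (lam g : ℂ) :
    (seaShell k).HasValue lam g
      (lam ^ (∑ i, k i) * (g * conj g) ^ (2 * m - 1) * (eulerZagier k : ℂ)) := by
  intro ρ hρ
  have heq : ∀ j, (seaShell k).dampedAmplitude lam g (ρ j) =
      lam ^ (∑ i, k i) * (g * conj g) ^ (2 * m - 1) * ∑' d : DecreasingIndex m,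
        (((∏ e, ρ j e (seaShellMomenta k d.1 e)) * ezTerm k d.1 : ℝ) : ℂ) := by
    intro j
    rw [WeightedGraph.dampedAmplitude_eq_tsum _ lam g (ρ j) (hρ.nonneg j) (hρ.summable j),
      tsum_seaShell, card_seaShell_E, sum_seaShell_weight]
    simp only [seaShell_momentumWeight]
    ring
  simp only [heq]
  refine Tendsto.const_mul _ ?_
  rw [eulerZagier, Complex.ofReal_tsum]
  refine tendsto_tsum_of_dominated_convergence (summable_ezTerm hk) (fun d => ?_)
    (Eventually.of_forall fun j d => ?_)
  · refine (Complex.continuous_ofReal.tendsto _).comp ?_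
    have h := tendsto_finsetProd (Finset.univ : Finset (seaShell k).E)
      fun e _ => hρ.tendsto e (seaShellMomenta k d.1 e)
    simpa using h.mul_const (ezTerm k d.1)
  · have h0 : 0 ≤ ∏ e, ρ j e (seaShellMomenta k d.1 e) :=
      Finset.prod_nonneg fun e _ => hρ.nonneg j e _
    have h1 : ∏ e, ρ j e (seaShellMomenta k d.1 e) ≤ 1 :=
      Finset.prod_le_one (fun e _ => hρ.nonneg j e _) fun e _ => hρ.le_one j e _
    rw [Complex.norm_real, Real.norm_of_nonneg (mul_nonneg h0 (ezTerm_nonneg k d.1))]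
    exact mul_le_of_le_one_left (ezTerm_nonneg k d.1) h1

end

theorem eulerZagierSums_subset_range_graphValue : eulerZagierSums ⊆ Set.range graphValue := by
  rintro z ⟨m, _, k, hk, rfl⟩
  have h : (seaShell k).HasValue 1 1 (eulerZagier k : ℂ) := by
    simpa using hasValue_seaShell hk 1 1
  let Γ : EvaluableGraph := ⟨seaShell k, _, h⟩
  -- `graphValue` is a chosen witness; uniqueness of values identifies it with the sum.
  exact ⟨Γ, WeightedGraph.HasValue.unique _ (graphValue_spec Γ) h⟩

end ZetaModel

theorem mainTheorem1 :
    (∀ (m : ℕ) [NeZero m] (k : Fin m → ℕ), ZetaModel.Admissible k →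
      (Summable fun n : ZetaModel.DecreasingIndex m => ZetaModel.ezTerm k n.1) ∧
      ∀ lam g : ℂ, (ZetaModel.seaShell k).HasValue lam g
        (lam ^ (∑ i, k i) * (g * (starRingEnd ℂ) g) ^ (2 * m - 1) *
          (ZetaModel.eulerZagier k : ℂ))) ∧
    ZetaModel.eulerZagierSums ⊆ Set.range ZetaModel.graphValue ∧
    Submodule.span ℚ ZetaModel.eulerZagierSums ≤
      LinearMap.range (Finsupp.linearCombination ℚ ZetaModel.graphValue) := by
  refine ⟨fun m _ k hk => ⟨ZetaModel.summable_ezTerm hk, ZetaModel.hasValue_seaShell hk⟩,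
    ZetaModel.eulerZagierSums_subset_range_graphValue, ?_⟩
  rw [Finsupp.range_linearCombination]
  exact Submodule.span_mono ZetaModel.eulerZagierSums_subset_range_graphValue
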